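/- A \emph{cpo} is a poset in which every increasing chain $x_0\le x_1\le\cdots$ has a supremum (no least element is required), and $\mathbf{CPO}$ is the category of cpo's and Scott-continuous functions (monotone functions preserving suprema of increasing chains). A \emph{$\mathbf{CPO}$-category} is a category whose hom-sets are cpo's and whose composition is Scott-continuous in both arguments; a \emph{$\mathbf{CPO}$-functor} is a functor that is Scott-continuous on hom-cpo's. $\mathbf{CPO}$ is a $\mathbf{CPO}$-category for the pointwise order; opposites carry the same order on hom-sets, products the componentwise order. A morphism $e:X\to Y$ of a $\mathbf{CPO}$-category is an \emph{embedding} if there is $p:Y\to X$ with $p\circ e=\mathrm{id}$ and $e\circ p\le\mathrm{id}$. An \emph{e-initial} object is an initial object such that every morphism out of it is an embedding. An \emph{LNL-FPC model} consists of (1) a $\mathbf{CPO}$-symmetric monoidal closed category $\mathbf D$ with finite $\mathbf{CPO}$-coproducts, with an e-initial object and with all $\omega$-colimits over embeddings; and (2) a $\mathbf{CPO}$-symmetric monoidal adjunction $F\dashv G$ with $F:\mathbf{CPO}\to\mathbf D$ and $G:\mathbf D\to\mathbf{CPO}$, where $\mathbf{CPO}$ has its cartesian monoidal structure. Put $T=G\circ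 F$. Consider the types \[A,B ::= c \mid TX \mid HA \mid A+B \mid A\times B \mid A\to B,\] where $X$ is a single type variable, $c$ ranges over the objects of $\mathbf{CPO}$ and $H$ over the $\mathbf{CPO}$-endofunctors of $\mathbf{CPO}$. For a $\mathbf{CPO}$-functor $K:\mathbf{CPO}^{\mathrm{op}}\times\mathbf{CPO}\to\mathbf{CPO}$ let \[K^\smallsmile=\langle K^{\mathrm{op}}\circ\langle\Pi_2,\Pi_1\rangle,\,K\rangle:\mathbf{CPO}^{\mathrm{op}}\times\mathbf{CPO}\to\mathbf{CPO}^{\mathrm{op}}\times\mathbf{CPO},\] where $\Pi_1,\Pi_2$ are the projections. Every type $A$ induces a $\mathbf{CPO}$-endofunctor $[\![X\vdash A]\!]$ of $\mathbf{CPO}^{\mathrm{op}}\times\mathbf{CPO}$ by \begin{align*} [\![X\vdash TX]\!] &= T^{\mathrm{op}}\times T,\\ [\![X\vdash c]\!] &= K_{(c,c)}\quad\text{(the constant functor)},\\ [\![X\vdash HA]\!] &= (H^{\mathrm{op}}\times H)\circ[\![X\vdash A]\!],\\ [\![X\vdash A+B]\!] &= \bigl({+}\circ\langle\Pi_2[\![X\vdash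 A]\!],\Pi_2[\![X\vdash B]\!]\rangle\bigr)^\smallsmile,\\ [\![X\vdash A\times B]\!] &= \bigl({\times}\circ\langle\Pi_2[\![X\vdash A]\!],\Pi_2[\![X\vdash B]\!]\rangle\bigr)^\smallsmile,\\ [\![X\vdash A\to B]\!] &= \bigl([-\to-]\circ\langle\Pi_1[\![X\vdash A]\!],\Pi_2[\![X\vdash B]\!]\rangle\bigr)^\smallsmile, \end{align*} where $+$ and $\times$ are the disjoint union and cartesian product of cpo's and $[-\to-]$ is the internal hom of $\mathbf{CPO}$. \textbf{Theorem.} For every LNL-FPC model and every type $A$, the functor $[\![X\vdash A]\!]$ factors through $F^{\mathrm{op}}\times F$, that is, $[\![X\vdash A]\!]=K\circ(F^{\mathrm{op}}\times F)$ for some $\mathbf{CPO}$-functor $K:\mathbf D^{\mathrm{op}}\times\mathbf D\to\mathbf{CPO}^{\mathrm{op}}\times\mathbf{CPO}$; and $[\![X\vdash A]\!]$ is algebraically compact: it has an initial algebra $[\![X\vdash A]\!](\Omega)\xrightarrow{\ \omega\ }\Omega$ such that $\Omega\xrightarrow{\ \omega^{-1}\ }[\![X\vdash A]\!](\Omega)$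 is a final coalgebra. -/

import Mathlib

open CategoryTheory CategoryTheory.Limits MonoidalCategory Opposite OmegaCompletePartialOrder

universe v w u₁ v₁ u₂ v₂ u₃ v₃ u₄ v₄ u

namespace LNLFPC

/-! ### CPO-enriched categories and functors

A cpo is a poset in which every increasing chain `x₀ ≤ x₁ ≤ ⋯` has a supremum
(`OmegaCompletePartialOrder`; no least element is required, the empty poset is a cpo).
`ωCPO` is the category of cpo's and Scott-continuous functions (monotone maps that preserve
suprema of increasing chains). -/

/-- A CPO-category: every hom-set is a cpo and composition is Scott-continuous in both
arguments. -/
class CPOCategory (C : Type u₁) [Category.{v₁} C] where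
  homCPO (X Y : C) : OmegaCompletePartialOrder (X ⟶ Y)
  comp_continuous_left {X Y Z : C} (g : Y ⟶ Z) :
    ωScottContinuous (fun f : X ⟶ Y => f ≫ g)
  comp_continuous_right {X Y Z : C} (f : X ⟶ Y) :
    ωScottContinuous (fun g : Y ⟶ Z => f ≫ g)

attribute [reducible, instance] CPOCategory.homCPO

/-- A CPO-functor: a functor whose action on hom-cpo's is Scott-continuous. -/
structure CPOFunctor (C : Type u₁) [Category.{v₁} C] [CPOCategory C]
    (D : Type u₂) [Category.{v₂} D] [CPOCategory D] where
  toFunctor : C ⥤ D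
  continuous_map (X Y : C) : ωScottContinuous (fun f : X ⟶ Y => toFunctor.map f)

/-- The set of Scott-continuous functions between two cpo's, with the pointwise order. -/
instance homωCPO (X Y : ωCPO.{u}) : OmegaCompletePartialOrder (X ⟶ Y) :=
  inferInstanceAs (OmegaCompletePartialOrder (X →𝒄 Y))

/-- A map into a function space is Scott-continuous if all its evaluations are. -/
theorem continuous_of_eval {α : Type u₁} [OmegaCompletePartialOrder α] {β : Type u₂}
    [OmegaCompletePartialOrder β] {γ : Type u₃} [OmegaCompletePartialOrder γ] {f : α → β →𝒄 γ}
    (hf : ∀ x, ωScottContinuous (fun a => f a x)) : ωScottContinuous f :=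
  ωScottContinuous.of_monotone_map_ωSup
    ⟨fun _ _ h x => (hf x).monotone h, fun c => ContinuousHom.ext _ _ fun x => (hf x).map_ωSup c⟩

theorem continuous_eval {β : Type u₂} [OmegaCompletePartialOrder β] {γ : Type u₃}
    [OmegaCompletePartialOrder γ] (x : β) : ωScottContinuous (fun f : β →𝒄 γ => f x) :=
  ContinuousHom.ωScottContinuous_apply ωScottContinuous.id ωScottContinuous.const

/-- `ωCPO` is a CPO-category for the pointwise order on Scott-continuous functions. -/
instance : CPOCategory ωCPO.{u} where
  homCPO X Y := homωCPO X Y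
  comp_continuous_left {X Y _} g :=
    continuous_of_eval fun x : X =>
      (ContinuousHom.ωScottContinuous g).comp (continuous_eval (γ := Y) x)
  comp_continuous_right f := continuous_of_eval fun x => continuous_eval (f x)

/-- The hom-sets of the opposite category carry the same order: `f ≤ g` iff `f.unop ≤ g.unop`. -/
instance opHomCPO {C : Type u₁} [Category.{v₁} C] [CPOCategory C] (X Y : Cᵒᵖ) :
    OmegaCompletePartialOrder (X ⟶ Y) :=
  letI : PartialOrder (X ⟶ Y) :=
    PartialOrder.lift (fun f : X ⟶ Y => f.unop) Quiver.Hom.unop_inj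
  OmegaCompletePartialOrder.lift (α := Y.unop ⟶ X.unop)
    ⟨fun f => f.unop, fun _ _ h => h⟩
    (fun c => (ωSup (c.map ⟨fun f => f.unop, fun _ _ h => h⟩)).op)
    (fun _ _ h => h) (fun _ => rfl)

theorem continuous_op {C : Type u₁} [Category.{v₁} C] [CPOCategory C] (X Y : C) :
    ωScottContinuous (fun f : X ⟶ Y => f.op) :=
  ωScottContinuous.of_monotone_map_ωSup ⟨fun _ _ h => h, fun _ => rfl⟩

theorem continuous_unop {C : Type u₁} [Category.{v₁} C] [CPOCategory C] (X Y : Cᵒᵖ) :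
    ωScottContinuous (fun f : X ⟶ Y => f.unop) :=
  ωScottContinuous.of_monotone_map_ωSup ⟨fun _ _ h => h, fun _ => rfl⟩

/-- The opposite of a CPO-category. -/
instance {C : Type u₁} [Category.{v₁} C] [CPOCategory C] : CPOCategory Cᵒᵖ where
  homCPO X Y := opHomCPO X Y
  comp_continuous_left {X Y _} g :=
    (continuous_op _ _).comp
      ((CPOCategory.comp_continuous_right g.unop).comp (continuous_unop X Y))
  comp_continuous_right {_ Y Z} f :=
    (continuous_op _ _).comp
      ((CPOCategory.comp_continuous_left f.unop).comp (continuous_unop Y Z))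

section Pairs

variable {α : Type u₁} {β : Type u₂} {γ : Type u₃}
  [OmegaCompletePartialOrder α] [OmegaCompletePartialOrder β] [OmegaCompletePartialOrder γ]

theorem continuous_fst : ωScottContinuous (fun p : α × β => p.1) :=
  ωScottContinuous.of_monotone_map_ωSup ⟨fun _ _ h => h.1, fun _ => rfl⟩

theorem continuous_snd : ωScottContinuous (fun p : α × β => p.2) :=
  ωScottContinuous.of_monotone_map_ωSup ⟨fun _ _ h => h.2, fun _ => rfl⟩

theorem continuous_pair {f : α → β} {g : α → γ} (hf : ωScottContinuous f)
    (hg : ωScottContinuous g) : ωScottContinuous (fun a => (f a, g a)) :=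
  ωScottContinuous.of_monotone_map_ωSup
    ⟨fun _ _ h => ⟨hf.monotone h, hg.monotone h⟩,
      fun c => Prod.ext (hf.map_ωSup c) (hg.map_ωSup c)⟩

end Pairs

/-- The product of two CPO-categories, with the componentwise order on pairs of morphisms. -/
instance {C : Type u₁} [Category.{v₁} C] [CPOCategory C] {D : Type u₂} [Category.{v₂} D]
    [CPOCategory D] : CPOCategory (C × D) where
  homCPO X Y := inferInstanceAs (OmegaCompletePartialOrder ((X.1 ⟶ Y.1) × (X.2 ⟶ Y.2)))
  comp_continuous_left {X Y _} g :=
    continuous_pair (α := (X.1 ⟶ Y.1) × (X.2 ⟶ Y.2))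
      ((CPOCategory.comp_continuous_left g.1).comp continuous_fst)
      ((CPOCategory.comp_continuous_left g.2).comp continuous_snd)
  comp_continuous_right {_ Y Z} f :=
    continuous_pair (α := (Y.1 ⟶ Z.1) × (Y.2 ⟶ Z.2))
      ((CPOCategory.comp_continuous_right f.1).comp continuous_fst)
      ((CPOCategory.comp_continuous_right f.2).comp continuous_snd)

namespace CPOFunctor

variable {C : Type u₁} [Category.{v₁} C] [CPOCategory C]
  {D : Type u₂} [Category.{v₂} D] [CPOCategory D]
  {E : Type u₃} [Category.{v₃} E] [CPOCategory E]
  {E' : Type u₄} [Category.{v₄} E'] [CPOCategory E']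

/-- Composition in diagrammatic order: `F.comp G` is `G ∘ F`. -/
def comp (F : CPOFunctor C D) (G : CPOFunctor D E) : CPOFunctor C E where
  toFunctor := F.toFunctor ⋙ G.toFunctor
  continuous_map X Y := (G.continuous_map _ _).comp (F.continuous_map X Y)

/-- The opposite functor `F^op`. -/
def op (F : CPOFunctor C D) : CPOFunctor Cᵒᵖ Dᵒᵖ where
  toFunctor := F.toFunctor.op
  continuous_map X Y :=
    (continuous_op _ _).comp ((F.continuous_map _ _).comp (continuous_unop X Y))

/-- The product functor `F × G`. -/
def prod (F : CPOFunctor C D) (G : CPOFunctor E E') : CPOFunctor (C × E) (D × E') where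
  toFunctor := F.toFunctor.prod G.toFunctor
  continuous_map X Y :=
    continuous_pair (α := (X.1 ⟶ Y.1) × (X.2 ⟶ Y.2))
      ((F.continuous_map _ _).comp continuous_fst) ((G.continuous_map _ _).comp continuous_snd)

/-- The pairing `⟨F, G⟩`. -/
def pair (F : CPOFunctor C D) (G : CPOFunctor C E) : CPOFunctor C (D × E) where
  toFunctor := F.toFunctor.prod' G.toFunctor
  continuous_map X Y := continuous_pair (F.continuous_map X Y) (G.continuous_map X Y)

variable (C D)

/-- The first projection `Π₁`. -/
def proj₁ : CPOFunctor (C × D) C where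
  toFunctor := CategoryTheory.Prod.fst C D
  continuous_map X Y := continuous_fst (α := X.1 ⟶ Y.1) (β := X.2 ⟶ Y.2)

/-- The second projection `Π₂`. -/
def proj₂ : CPOFunctor (C × D) D where
  toFunctor := CategoryTheory.Prod.snd C D
  continuous_map X Y := continuous_snd (α := X.1 ⟶ Y.1) (β := X.2 ⟶ Y.2)

variable {D}

/-- The constant functor `K_d`. -/
def const (d : D) : CPOFunctor C D where
  toFunctor := (Functor.const C).obj d
  continuous_map _ _ := ωScottContinuous.const (x := 𝟙 d)

/-- The swap `⟨Π₂, Π₁⟩ : C^op × C → (C^op × C)^op = C × C^op`. -/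
def swap : CPOFunctor (Cᵒᵖ × C) (Cᵒᵖ × C)ᵒᵖ where
  toFunctor :=
    { obj := fun X => Opposite.op (Opposite.op X.2, X.1.unop)
      map := fun {X Y} f =>
        Quiver.Hom.op (X := (Opposite.op Y.2, Y.1.unop)) (Y := (Opposite.op X.2, X.1.unop))
          (f.2.op, f.1.unop) }
  continuous_map X Y := by
    refine (continuous_op (C := Cᵒᵖ × C) (Opposite.op Y.2, Y.1.unop)
      (Opposite.op X.2, X.1.unop)).comp ?_
    exact continuous_pair (α := (X.1 ⟶ Y.1) × (X.2 ⟶ Y.2))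
      ((continuous_op _ _).comp continuous_snd) ((continuous_unop _ _).comp continuous_fst)

variable {C}

/-- For `H : C^op × C → C`, the endofunctor `⟨H^op ∘ ⟨Π₂, Π₁⟩, H⟩` of `C^op × C`. -/
def cup (H : CPOFunctor (Cᵒᵖ × C) C) : CPOFunctor (Cᵒᵖ × C) (Cᵒᵖ × C) :=
  pair ((swap C).comp H.op) H

end CPOFunctor

/-! ### Products, sums and function spaces of cpo's -/

/-- Products of cpo's are cartesian products with the componentwise order, and the terminal cpo is
the one-point poset; this is the cartesian monoidal structure of `ωCPO`. -/
instance : CartesianMonoidalCategory ωCPO.{u} :=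
  .ofChosenFiniteProducts
    ⟨asEmptyCone (ωCPO.of PUnit.{u + 1}),
      IsTerminal.ofUniqueHom (fun _ => ContinuousHom.const PUnit.unit) (fun _ _ => rfl)⟩
    fun X Y =>
      ⟨BinaryFan.mk (P := ωCPO.of (X × Y)) (ContinuousHom.ofFun Prod.fst continuous_fst)
          (ContinuousHom.ofFun Prod.snd continuous_snd),
        BinaryFan.IsLimit.mk _
          (fun f g => ContinuousHom.ofFun (fun x => (f x, g x))
            (continuous_pair f.ωScottContinuous g.ωScottContinuous))
          (fun _ _ => rfl) (fun _ _ => rfl)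
          (fun f g m hf hg => by subst hf; subst hg; rfl)⟩

/-- The symmetry of the cartesian monoidal structure of `ωCPO`. -/
instance : BraidedCategory ωCPO.{u} := .ofCartesianMonoidalCategory

/-- The functor `× : CPO × CPO → CPO`. -/
def prodFunctor : CPOFunctor (ωCPO.{u} × ωCPO.{u}) ωCPO.{u} where
  toFunctor :=
    { obj := fun X => ωCPO.of (X.1 × X.2)
      map := fun {X Y} f => ContinuousHom.ofFun (fun p => (f.1 p.1, f.2 p.2))
        (continuous_pair (f.1.ωScottContinuous.comp continuous_fst)
          (f.2.ωScottContinuous.comp continuous_snd)) }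
  continuous_map X Y := ωScottContinuous.of_monotone_map_ωSup
    ⟨fun f g h p => ⟨h.1 p.1, h.2 p.2⟩, fun c => rfl⟩

section Sum

variable {α β : Type u} [OmegaCompletePartialOrder α] [OmegaCompletePartialOrder β]

/-- The element of `α` at which `x : α ⊕ β` lies, or `a` if `x` lies in `β`. -/
def leftOr (a : α) (x : α ⊕ β) : α := Sum.elim id (fun _ => a) x

/-- The element of `β` at which `x : α ⊕ β` lies, or `b` if `x` lies in `α`. -/
def rightOr (b : β) (x : α ⊕ β) : β := Sum.elim (fun _ => b) id x

theorem leftOr_mono (a : α) : Monotone (leftOr (β := β) a) := by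
  rintro _ _ (h | h)
  · exact h
  · exact le_refl a

theorem rightOr_mono (b : β) : Monotone (rightOr (α := α) b) := by
  rintro _ _ (h | h)
  · exact le_refl b
  · exact h

/-- A chain in the disjoint union lies in one of the summands; its supremum is taken there. -/
def sumSup (c : Chain (α ⊕ β)) : α ⊕ β :=
  match c 0 with
  | .inl a => .inl (ωSup (c.map ⟨leftOr a, leftOr_mono a⟩))
  | .inr b => .inr (ωSup (c.map ⟨rightOr b, rightOr_mono b⟩))

/-- The disjoint union of two cpo's: elements of different summands are incomparable. -/
instance sumCPO : OmegaCompletePartialOrder (α ⊕ β) where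
  ωSup := sumSup
  le_ωSup c i := by
    have h0 : c 0 ≤ c i := c.monotone (Nat.zero_le i)
    unfold sumSup
    rcases h : c 0 with a | b <;> rw [h] at h0
    · rcases hi : c i with a' | b' <;> rw [hi] at h0
      · refine Sum.inl_le_inl_iff.2 (le_ωSup_of_le i ?_)
        simp [leftOr, hi]
      · exact (Sum.not_inl_le_inr h0).elim
    · rcases hi : c i with a' | b' <;> rw [hi] at h0
      · exact (Sum.not_inr_le_inl h0).elim
      · refine Sum.inr_le_inr_iff.2 (le_ωSup_of_le i ?_)
        simp [rightOr, hi]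
  ωSup_le c x hx := by
    have h0 := hx 0
    unfold sumSup
    rcases h : c 0 with a | b <;> rw [h] at h0 <;> rcases x with a' | b'
    · exact Sum.inl_le_inl_iff.2 (ωSup_le _ _ fun i =>
        (leftOr_mono a (hx i) : leftOr a (c i) ≤ a'))
    · exact (Sum.not_inl_le_inr h0).elim
    · exact (Sum.not_inr_le_inl h0).elim
    · exact Sum.inr_le_inr_iff.2 (ωSup_le _ _ fun i =>
        (rightOr_mono b (hx i) : rightOr b (c i) ≤ b'))

theorem continuous_inl : ωScottContinuous (Sum.inl : α → α ⊕ β) :=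
  ωScottContinuous.of_monotone_map_ωSup ⟨Sum.inl_mono, fun _ => rfl⟩

theorem continuous_inr : ωScottContinuous (Sum.inr : β → α ⊕ β) :=
  ωScottContinuous.of_monotone_map_ωSup ⟨Sum.inr_mono, fun _ => rfl⟩

theorem continuous_sumElim {γ : Type u} [OmegaCompletePartialOrder γ] {f : α → γ} {g : β → γ}
    (hf : ωScottContinuous f) (hg : ωScottContinuous g) :
    ωScottContinuous (Sum.elim f g) := by
  have hm : Monotone (Sum.elim f g) := by
    rintro _ _ (h | h)
    · exact hf.monotone h
    · exact hg.monotone h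
  refine ωScottContinuous.of_monotone_map_ωSup ⟨hm, fun c => ?_⟩
  change Sum.elim f g (sumSup c) = _
  unfold sumSup
  rcases h : c 0 with a | b
  · refine (hf.map_ωSup _).trans (congrArg ωSup (Chain.ext (funext fun i => ?_)))
    have h0 : c 0 ≤ c i := c.monotone (Nat.zero_le i)
    rw [h] at h0
    rcases hi : c i with a' | b' <;> rw [hi] at h0
    · simp [leftOr, hi]
    · exact (Sum.not_inl_le_inr h0).elim
  · refine (hg.map_ωSup _).trans (congrArg ωSup (Chain.ext (funext fun i => ?_)))
    have h0 : c 0 ≤ c i := c.monotone (Nat.zero_le i)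
    rw [h] at h0
    rcases hi : c i with a' | b' <;> rw [hi] at h0
    · exact (Sum.not_inr_le_inl h0).elim
    · simp [rightOr, hi]

end Sum

/-- The functor `+ : CPO × CPO → CPO`. -/
def sumFunctor : CPOFunctor (ωCPO.{u} × ωCPO.{u}) ωCPO.{u} where
  toFunctor :=
    { obj := fun X => ωCPO.of (X.1 ⊕ X.2)
      map := fun {X Y} f => ContinuousHom.ofFun
        (Sum.elim (fun a => Sum.inl (f.1 a)) (fun b => Sum.inr (f.2 b)))
        (continuous_sumElim (continuous_inl.comp f.1.ωScottContinuous)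
          (continuous_inr.comp f.2.ωScottContinuous))
      map_id := fun X => ContinuousHom.ext _ _ (by rintro (a | b) <;> rfl)
      map_comp := fun f g => ContinuousHom.ext _ _ (by rintro (a | b) <;> rfl) }
  continuous_map X Y := ωScottContinuous.of_monotone_map_ωSup
    ⟨fun f g h => by
      rintro (a | b)
      · exact Sum.inl_le_inl_iff.2 (h.1 a)
      · exact Sum.inr_le_inr_iff.2 (h.2 b),
     fun c => ContinuousHom.ext _ _ (by rintro (a | b) <;> rfl)⟩

/-- The internal hom `[- → -] : CPO^op × CPO → CPO`: the cpo of Scott-continuous functions with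
the pointwise order; `[f → g]` sends `h` to `g ∘ h ∘ f`. -/
def homFunctor : CPOFunctor (ωCPO.{u}ᵒᵖ × ωCPO.{u}) ωCPO.{u} where
  toFunctor :=
    { obj := fun X => ωCPO.of (X.1.unop →𝒄 X.2)
      map := fun {X Y} f => ContinuousHom.ofFun
        (fun h : X.1.unop →𝒄 X.2 => (f.2 : X.2 →𝒄 Y.2).comp (h.comp f.1.unop))
        ((CPOCategory.comp_continuous_left (C := ωCPO.{u}) (X := Y.1.unop) f.2).comp
          (CPOCategory.comp_continuous_right (C := ωCPO.{u}) f.1.unop)) }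
  continuous_map X Y := continuous_of_eval fun k => continuous_of_eval fun x =>
    ContinuousHom.ωScottContinuous_apply
      (continuous_snd (α := X.1 ⟶ Y.1) (β := X.2 ⟶ Y.2))
      (k.ωScottContinuous.comp ((continuous_eval (γ := X.1.unop) x).comp
        ((continuous_unop X.1 Y.1).comp (continuous_fst (α := X.1 ⟶ Y.1) (β := X.2 ⟶ Y.2)))))

/-! ### Types and their interpretation -/

/-- Types with one type variable `X`: `A, B ::= c | T X | H A | A + B | A × B | A → B`, where `c`
ranges over cpo's and `H` over CPO-endofunctors of `CPO`. -/
inductive MixedType : Type (u + 1)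
  | const (c : ωCPO.{u}) : MixedType
  | monad : MixedType
  | app (H : CPOFunctor ωCPO.{u} ωCPO.{u}) (A : MixedType) : MixedType
  | sum (A B : MixedType) : MixedType
  | prod (A B : MixedType) : MixedType
  | arrow (A B : MixedType) : MixedType

/-- The interpretation `⟦X ⊢ A⟧` as a CPO-endofunctor of `CPO^op × CPO`. -/
def interp (T : CPOFunctor ωCPO.{u} ωCPO.{u}) :
    MixedType.{u} → CPOFunctor (ωCPO.{u}ᵒᵖ × ωCPO.{u}) (ωCPO.{u}ᵒᵖ × ωCPO.{u})
  | .const c => CPOFunctor.const _ (op c, c)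
  | .monad => T.op.prod T
  | .app H A => (interp T A).comp (H.op.prod H)
  | .sum A B =>
      ((((interp T A).comp (CPOFunctor.proj₂ _ _)).pair
        ((interp T B).comp (CPOFunctor.proj₂ _ _))).comp sumFunctor).cup
  | .prod A B =>
      ((((interp T A).comp (CPOFunctor.proj₂ _ _)).pair
        ((interp T B).comp (CPOFunctor.proj₂ _ _))).comp prodFunctor).cup
  | .arrow A B =>
      ((((interp T A).comp (CPOFunctor.proj₁ _ _)).pair
        ((interp T B).comp (CPOFunctor.proj₂ _ _))).comp homFunctor).cup

/-! ### Algebraic compactness -/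

/-- An endofunctor is algebraically compact if it has an initial algebra `ω : T Ω → Ω` (whose
structure map is then invertible) such that `ω⁻¹ : Ω → T Ω` is a final coalgebra. -/
def AlgebraicallyCompact {C : Type u₁} [Category.{v₁} C] (T : C ⥤ C) : Prop :=
  ∃ (Ω : C) (ω : T.obj Ω ≅ Ω),
    Nonempty (IsInitial (⟨Ω, ω.hom⟩ : Endofunctor.Algebra T)) ∧
    Nonempty (IsTerminal (⟨Ω, ω.inv⟩ : Endofunctor.Coalgebra T))

/-! ### LNL-FPC models -/

/-- `e` is an embedding: there is `p` with `p ∘ e = id` and `e ∘ p ≤ id`. -/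
def IsEmbedding {C : Type u₁} [Category.{v₁} C] [CPOCategory C] {X Y : C} (e : X ⟶ Y) : Prop :=
  ∃ p : Y ⟶ X, e ≫ p = 𝟙 X ∧ p ≫ e ≤ 𝟙 Y

/-- An LNL-FPC model on a CPO-category `D`. The CPO-enriched notions are the ordinary ones together
with Scott-continuity of the functors involved, as every natural transformation between CPO-functors
is CPO-natural. -/
structure LNLFPCModel (D : Type w) [Category.{u} D] [CPOCategory D] [MonoidalCategory D]
    [SymmetricCategory D] [MonoidalClosed D] where
  /-- The tensor product is a CPO-functor `D × D → D`. -/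
  continuous_tensor (X X' Y Y' : D) :
    ωScottContinuous (fun f : (X ⟶ X') × (Y ⟶ Y') => f.1 ⊗ₘ f.2)
  /-- The right adjoints of the functors `X ⊗ -` are CPO-functors. -/
  continuous_ihom (X Y Z : D) : ωScottContinuous (fun f : Y ⟶ Z => (ihom X).map f)
  hasFiniteCoproducts : HasFiniteCoproducts D
  /-- The bijection `D(X, Z) × D(Y, Z) ≃ D(X + Y, Z)` is Scott-continuous (its inverse, given by
  composition, always is). -/
  continuous_desc (X Y Z : D) :
    ωScottContinuous (fun f : (X ⟶ Z) × (Y ⟶ Z) => coprod.desc f.1 f.2)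
  /-- There is an e-initial object. -/
  eInitial : ∃ Z : D, Nonempty (IsInitial Z) ∧ ∀ (X : D) (e : Z ⟶ X), IsEmbedding e
  /-- All `ω`-colimits over embeddings exist. -/
  hasColimit (K : ℕ ⥤ D) (hK : ∀ {m n : ℕ} (f : m ⟶ n), IsEmbedding (K.map f)) : HasColimit K
  /-- The left adjoint. -/
  F : CPOFunctor ωCPO.{u} D
  /-- The right adjoint. -/
  G : CPOFunctor D ωCPO.{u}
  adj : F.toFunctor ⊣ G.toFunctor
  /-- `F` is a symmetric monoidal functor. -/
  laxBraidedF : F.toFunctor.LaxBraided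
  /-- `G` is a symmetric monoidal functor. -/
  laxBraidedG : G.toFunctor.LaxBraided
  unit_isMonoidal : NatTrans.IsMonoidal adj.unit
  counit_isMonoidal : NatTrans.IsMonoidal adj.counit

/-- The monad `T = G ∘ F` of the adjunction, as a CPO-endofunctor of `CPO`. -/
def LNLFPCModel.T {D : Type w} [Category.{u} D] [CPOCategory D] [MonoidalCategory D]
    [SymmetricCategory D] [MonoidalClosed D] (M : LNLFPCModel.{w, u} D) :
    CPOFunctor ωCPO.{u} ωCPO.{u} :=
  M.F.comp M.G

end LNLFPC

namespace LNLFPC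

/-! ### Suprema of monotone sequences -/

section Lub

variable {α : Type u₁} [OmegaCompletePartialOrder α] {β : Type u₂} [OmegaCompletePartialOrder β]

/-! `CPO` has no zero object, so the usual fixed-point construction is not available there and has
to be carried out in `Dᵒᵖ × D`. The type variable occurs only under `T = G ∘ F`, so every
interpretation is `K ∘ L` with `L = Fᵒᵖ × F` (`exists_factor`). A fixed point of `L ∘ K` yields one
of `K ∘ L`, with both universal properties (`existsUnique_algebraHom_comp`,
`existsUnique_coalgebraHom_comp`). In `D`, closedness turns the e-initial object into a zero object
with least zero maps (`isLeastZero_of_eInitial`), and the limit-colimit coincidence turns colimits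
over embeddings into bilimits (`IsEPChain.exists_isBilimit`). Both structures are self-dual and
componentwise, hence pass to `Dᵒᵖ × D`. There every CPO-endofunctor has a minimal invariant, whose
self-dual characterization gives initiality and finality
(`IsMinimalInvariant.existsUnique_algebraHom`, `IsMinimalInvariant.existsUnique_coalgebraHom`). -/

theorem exists_isLUB_of_monotone {c : ℕ → α} (hc : Monotone c) : ∃ x, IsLUB (Set.range c) x :=
  ⟨_, isLUB_range_ωSup ⟨c, hc⟩⟩

theorem isLUB_map {f : α → β} (hf : ωScottContinuous f) {c : ℕ → α} (hc : Monotone c) {x : α}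
    (hx : IsLUB (Set.range c) x) : IsLUB (Set.range fun n => f (c n)) (f x) := by
  obtain rfl := ωSup_eq_of_isLUB (c := (⟨c, hc⟩ : Chain α)) hx
  exact hf.isLUB (c := (⟨c, hc⟩ : Chain α))

theorem isLUB_of_eventually_eq {c : ℕ → α} (hc : Monotone c) {x : α} {m : ℕ}
    (h : ∀ n, m ≤ n → c n = x) : IsLUB (Set.range c) x := by
  refine ⟨?_, fun y hy => h m le_rfl ▸ hy ⟨m, rfl⟩⟩
  rintro _ ⟨n, rfl⟩
  exact (hc (le_max_right m n)).trans (h _ (le_max_left m n)).le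

theorem isLUB_shift {c : ℕ → α} (hc : Monotone c) {x : α}
    (h : IsLUB (Set.range c) x) : IsLUB (Set.range fun n => c (n + 1)) x := by
  refine ⟨?_, fun y hy => h.2 ?_⟩
  · rintro _ ⟨n, rfl⟩
    exact h.1 ⟨n + 1, rfl⟩
  · rintro _ ⟨n, rfl⟩
    exact (hc (Nat.le_succ n)).trans (hy ⟨n, rfl⟩)

/-- Kleene iteration. As a cpo need not have a least element, the iteration starts at a given `x ≤ φ
x`. -/
theorem exists_fixedPoint {φ : α → α} (hφ : ωScottContinuous φ) {x : α} (hx : x ≤ φ x) :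
    ∃ y, φ y = y :=
  ⟨_, fixedPoints.ωSup_iterate_mem_fixedPoint (ContinuousHom.ofFun φ hφ) x hx⟩

end Lub

/-! ### Initial algebras and final coalgebras of composites -/

section Composite

variable {C : Type u₁} [Category.{v₁} C] {D : Type u₂} [Category.{v₂} D]

theorem algebraicallyCompact_of_existsUnique {S : C ⥤ C} {Ω : C} (i : S.obj Ω ≅ Ω)
    (h : ∀ (Y : C) (a : S.obj Y ⟶ Y), ∃! f : Ω ⟶ Y, S.map f ≫ a = i.hom ≫ f)
    (h' : ∀ (Y : C) (a : Y ⟶ S.obj Y), ∃! f : Y ⟶ Ω, a ≫ S.map f = f ≫ i.inv) :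
    AlgebraicallyCompact S := by
  choose f hf hf' using h
  choose g hg hg' using h'
  exact ⟨Ω, i, ⟨IsInitial.ofUniqueHom (fun Y => ⟨f Y.a Y.str, hf Y.a Y.str⟩)
      fun Y m => Endofunctor.Algebra.Hom.ext (hf' Y.a Y.str m.f m.h)⟩,
    ⟨IsTerminal.ofUniqueHom (fun Y => ⟨g Y.V Y.str, hg Y.V Y.str⟩)
      fun Y m => Endofunctor.Coalgebra.Hom.ext (hg' Y.V Y.str m.f m.h)⟩⟩

/-- If `i : L K Ω → Ω` is an initial algebra of `L K`, then `K i` is one of `K L`. -/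
theorem existsUnique_algebraHom_comp {L : C ⥤ D} {K : D ⥤ C} {Ω : D} (i : L.obj (K.obj Ω) ≅ Ω)
    (h : ∀ (Y : D) (a : L.obj (K.obj Y) ⟶ Y), ∃! f : Ω ⟶ Y, L.map (K.map f) ≫ a = i.hom ≫ f)
    (Y : C) (a : K.obj (L.obj Y) ⟶ Y) :
    ∃! f : K.obj Ω ⟶ Y, K.map (L.map f) ≫ a = K.map i.hom ≫ f := by
  -- `L a` makes `L Y` an algebra of `L K`; applying `K` to the map from `Ω` and composing with `a`
  -- lands in `Y`.
  obtain ⟨f, hf, hf'⟩ := h (L.obj Y) (L.map a)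
  refine ⟨K.map f ≫ a, ?_, fun g hg => ?_⟩
  · have := congrArg K.map hf
    rw [Functor.map_comp, Functor.map_comp] at this
    simp [reassoc_of% this]
  -- Conversely, a homomorphism `g` out of `K Ω` gives one out of `Ω`, which is therefore `f`, and
  -- `g` is recovered from it.
  · have hgf : i.inv ≫ L.map g = f := hf' _ (by
      simp only [Functor.map_comp, Category.assoc, Iso.hom_inv_id_assoc]
      rw [← L.map_comp, hg, ← L.map_comp, ← Category.assoc, ← K.map_comp, i.inv_hom_id,
        K.map_id, Category.id_comp])
    rw [← hgf, K.map_comp, Category.assoc, hg, ← Category.assoc, ← K.map_comp, i.inv_hom_id,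
      K.map_id, Category.id_comp]

/-- If `i⁻¹ : Ω → L K Ω` is a final coalgebra of `L K`, then `K i⁻¹` is one of `K L`. -/
theorem existsUnique_coalgebraHom_comp {L : C ⥤ D} {K : D ⥤ C} {Ω : D}
    (i : L.obj (K.obj Ω) ≅ Ω)
    (h : ∀ (Y : D) (a : Y ⟶ L.obj (K.obj Y)), ∃! f : Y ⟶ Ω, a ≫ L.map (K.map f) = f ≫ i.inv)
    (Y : C) (a : Y ⟶ K.obj (L.obj Y)) :
    ∃! f : Y ⟶ K.obj Ω, a ≫ K.map (L.map f) = f ≫ K.map i.inv := by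
  obtain ⟨f, hf, hf'⟩ := h (L.obj Y) (L.map a)
  refine ⟨a ≫ K.map f, ?_, fun g hg => ?_⟩
  · have := congrArg K.map hf
    rw [Functor.map_comp, Functor.map_comp] at this
    simp [this]
  · have hgf : L.map g ≫ i.hom = f := hf' _ (by
      simp only [Functor.map_comp, Category.assoc, Iso.hom_inv_id, Category.comp_id]
      rw [← L.map_comp_assoc, hg, ← L.map_comp, Category.assoc, ← K.map_comp, i.inv_hom_id,
        K.map_id, Category.comp_id])
    rw [← hgf, K.map_comp, ← Category.assoc, hg, Category.assoc, ← K.map_comp, i.inv_hom_id,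
      K.map_id, Category.comp_id]

end Composite

section Category

variable {C : Type u₁} [Category.{v₁} C] [CPOCategory C]
  {D : Type u₂} [Category.{v₂} D] [CPOCategory D]

theorem comp_le_comp {X Y Z : C} {f f' : X ⟶ Y} {g g' : Y ⟶ Z} (hf : f ≤ f') (hg : g ≤ g') :
    f ≫ g ≤ f' ≫ g' :=
  ((CPOCategory.comp_continuous_left g).monotone hf).trans
    ((CPOCategory.comp_continuous_right f').monotone hg)

/-- Continuity in each argument gives a double supremum, and the diagonal is cofinal. -/
theorem isLUB_comp {X Y Z : C} {c : ℕ → (X ⟶ Y)} {d : ℕ → (Y ⟶ Z)} (hc : Monotone c)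
    (hd : Monotone d) {f : X ⟶ Y} {g : Y ⟶ Z} (hf : IsLUB (Set.range c) f)
    (hg : IsLUB (Set.range d) g) : IsLUB (Set.range fun n => c n ≫ d n) (f ≫ g) := by
  refine ⟨?_, fun y hy => ?_⟩
  · rintro _ ⟨n, rfl⟩
    exact comp_le_comp (hf.1 ⟨n, rfl⟩) (hg.1 ⟨n, rfl⟩)
  · refine (isLUB_map (CPOCategory.comp_continuous_left g) hc hf).2 ?_
    rintro _ ⟨m, rfl⟩
    refine (isLUB_map (CPOCategory.comp_continuous_right (c m)) hd hg).2 ?_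
    rintro _ ⟨n, rfl⟩
    exact (comp_le_comp (hc (le_max_left m n)) (hd (le_max_right m n))).trans (hy ⟨_, rfl⟩)

/-! ### Least zero objects and bilimits -/

/-- A zero object such that the zero endomorphism of every object lies below the identity. -/
structure IsLeastZero (Z : C) : Prop where
  isZero : IsZero Z
  comp_le_id {X : C} (a : X ⟶ Z) (b : Z ⟶ X) : a ≫ b ≤ 𝟙 X

/-- Compose the inequality between the zero endomorphism of `X` and the identity with `f`; the left
side remains a zero morphism. -/
theorem IsLeastZero.comp_le {Z : C} (hZ : IsLeastZero Z) {X Y : C} (a : X ⟶ Z) (b : Z ⟶ Y)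
    (f : X ⟶ Y) : a ≫ b ≤ f := by
  have h := comp_le_comp (hZ.comp_le_id a (hZ.isZero.to_ X)) (le_refl f)
  rwa [Category.id_comp, Category.assoc, hZ.isZero.eq_of_src (hZ.isZero.to_ X ≫ f) b] at h

theorem IsLeastZero.op {Z : C} (hZ : IsLeastZero Z) : IsLeastZero (Opposite.op Z) where
  isZero := hZ.isZero.op
  comp_le_id a b := hZ.comp_le_id b.unop a.unop

theorem IsLeastZero.prod {Z : C} {W : D} (hZ : IsLeastZero Z) (hW : IsLeastZero W) :
    IsLeastZero ((Z, W) : C × D) where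
  isZero :=
    { unique_to := fun Y => ⟨⟨⟨(hZ.isZero.to_ Y.1, hW.isZero.to_ Y.2)⟩,
        fun _ => Prod.ext (hZ.isZero.eq_of_src _ _) (hW.isZero.eq_of_src _ _)⟩⟩
      unique_from := fun Y => ⟨⟨⟨(hZ.isZero.from_ Y.1, hW.isZero.from_ Y.2)⟩,
        fun _ => Prod.ext (hZ.isZero.eq_of_tgt _ _) (hW.isZero.eq_of_tgt _ _)⟩⟩ }
  comp_le_id a b := ⟨hZ.comp_le_id a.1 b.1, hW.comp_le_id a.2 b.2⟩

/-- A sequence of embeddings `e n` with projections `p n`. -/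
structure IsEPChain (X : ℕ → C) (e : ∀ n, X n ⟶ X (n + 1)) (p : ∀ n, X (n + 1) ⟶ X n) :
    Prop where
  comp_eq n : e n ≫ p n = 𝟙 (X n)
  comp_le n : p n ≫ e n ≤ 𝟙 (X (n + 1))

/-- The object `B` with embeddings `ι n` and projections `π n` is a bilimit of the sequence. -/
structure IsBilimit {X : ℕ → C} (e : ∀ n, X n ⟶ X (n + 1)) (p : ∀ n, X (n + 1) ⟶ X n)
    {B : C} (ι : ∀ n, X n ⟶ B) (π : ∀ n, B ⟶ X n) : Prop where
  comp_eq n : ι n ≫ π n = 𝟙 (X n)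
  comp_ι n : e n ≫ ι (n + 1) = ι n
  π_comp n : π (n + 1) ≫ p n = π n
  monotone : Monotone fun n => π n ≫ ι n
  isLUB : IsLUB (Set.range fun n => π n ≫ ι n) (𝟙 B)

variable (C) in
/-- Every sequence of embeddings with projections has a bilimit. -/
def HasBilimits : Prop :=
  ∀ (X : ℕ → C) (e : ∀ n, X n ⟶ X (n + 1)) (p : ∀ n, X (n + 1) ⟶ X n), IsEPChain X e p →
    ∃ (B : C) (ι : ∀ n, X n ⟶ B) (π : ∀ n, B ⟶ X n), IsBilimit e p ι π

/-- Passing to the opposite exchanges embeddings and projections and keeps the order, so a bilimit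
stays a bilimit. For mere colimits this would fail. -/
theorem HasBilimits.op (h : HasBilimits C) : HasBilimits Cᵒᵖ := by
  intro X e p hX
  obtain ⟨B, ι, π, hB⟩ := h (fun n => (X n).unop) (fun n => (p n).unop) (fun n => (e n).unop)
    ⟨fun n => Quiver.Hom.op_inj (hX.comp_eq n), fun n => hX.comp_le n⟩
  refine ⟨Opposite.op B, fun n => (π n).op, fun n => (ι n).op,
    ⟨fun n => Quiver.Hom.unop_inj (hB.comp_eq n), fun n => Quiver.Hom.unop_inj (hB.π_comp n),
      fun n => Quiver.Hom.unop_inj (hB.comp_ι n), fun _ _ h => hB.monotone h, ?_, ?_⟩⟩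
  · rintro _ ⟨n, rfl⟩
    exact hB.isLUB.1 ⟨n, rfl⟩
  · intro f hf
    refine hB.isLUB.2 (?_ : f.unop ∈ _)
    rintro _ ⟨n, rfl⟩
    exact hf ⟨n, rfl⟩

theorem HasBilimits.prod (hC : HasBilimits C) (hD : HasBilimits D) : HasBilimits (C × D) := by
  intro X e p hX
  obtain ⟨B, ι, π, hB⟩ := hC (fun n => (X n).1) (fun n => (e n).1) (fun n => (p n).1)
    ⟨fun n => congrArg Prod.fst (hX.comp_eq n), fun n => (hX.comp_le n).1⟩
  obtain ⟨B', ι', π', hB'⟩ := hD (fun n => (X n).2) (fun n => (e n).2) (fun n => (p n).2)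
    ⟨fun n => congrArg Prod.snd (hX.comp_eq n), fun n => (hX.comp_le n).2⟩
  refine ⟨(B, B'), fun n => (ι n, ι' n), fun n => (π n, π' n),
    ⟨fun n => Prod.ext (hB.comp_eq n) (hB'.comp_eq n),
      fun n => Prod.ext (hB.comp_ι n) (hB'.comp_ι n),
      fun n => Prod.ext (hB.π_comp n) (hB'.π_comp n),
      fun _ _ h => ⟨hB.monotone h, hB'.monotone h⟩, ?_, ?_⟩⟩
  · rintro _ ⟨n, rfl⟩
    exact ⟨hB.isLUB.1 ⟨n, rfl⟩, hB'.isLUB.1 ⟨n, rfl⟩⟩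
  · intro f hf
    constructor
    · refine hB.isLUB.2 (?_ : f.1 ∈ _)
      rintro _ ⟨n, rfl⟩
      exact (hf ⟨n, rfl⟩).1
    · refine hB'.isLUB.2 (?_ : f.2 ∈ _)
      rintro _ ⟨n, rfl⟩
      exact (hf ⟨n, rfl⟩).2

/-! ### Preservation and uniqueness of bilimits -/

section Uniqueness

variable {X : ℕ → C} {e : ∀ n, X n ⟶ X (n + 1)} {p : ∀ n, X (n + 1) ⟶ X n}
  {B : C} {ι : ∀ n, X n ⟶ B} {π : ∀ n, B ⟶ X n}
  {B' : C} {ι' : ∀ n, X n ⟶ B'} {π' : ∀ n, B' ⟶ X n}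

theorem IsBilimit.shift (h : IsBilimit e p ι π) :
    IsBilimit (fun n => e (n + 1)) (fun n => p (n + 1)) (fun n => ι (n + 1))
      (fun n => π (n + 1)) where
  comp_eq _ := h.comp_eq _
  comp_ι _ := h.comp_ι _
  π_comp _ := h.π_comp _
  monotone _ _ hmn := h.monotone (Nat.succ_le_succ hmn)
  isLUB := isLUB_shift h.monotone h.isLUB

theorem IsEPChain.map (hX : IsEPChain X e p) (S : CPOFunctor C D) :
    IsEPChain (fun n => S.toFunctor.obj (X n)) (fun n => S.toFunctor.map (e n))
      (fun n => S.toFunctor.map (p n)) where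
  comp_eq n := by rw [← Functor.map_comp, hX.comp_eq, CategoryTheory.Functor.map_id]
  comp_le n := by
    rw [← Functor.map_comp, ← CategoryTheory.Functor.map_id]
    exact (S.continuous_map _ _).monotone (hX.comp_le n)

/-- A bilimit is given by equations and one supremum in a hom-cpo, so local continuity suffices to
preserve it. -/
theorem IsBilimit.map (h : IsBilimit e p ι π) (S : CPOFunctor C D) :
    IsBilimit (fun n => S.toFunctor.map (e n)) (fun n => S.toFunctor.map (p n))
      (fun n => S.toFunctor.map (ι n)) (fun n => S.toFunctor.map (π n)) where
  comp_eq n := by rw [← Functor.map_comp, h.comp_eq, CategoryTheory.Functor.map_id]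
  comp_ι n := by rw [← Functor.map_comp, h.comp_ι]
  π_comp n := by rw [← Functor.map_comp, h.π_comp]
  monotone m n hmn := by
    simpa using (S.continuous_map _ _).monotone (h.monotone hmn)
  isLUB := by
    simpa using isLUB_map (S.continuous_map _ _) h.monotone h.isLUB

theorem IsBilimit.monotone_comp (hX : IsEPChain X e p) (h : IsBilimit e p ι π)
    (h' : IsBilimit e p ι' π') : Monotone fun n => π n ≫ ι' n :=
  monotone_nat_of_le_succ fun n => by
    have := comp_le_comp (le_refl (π (n + 1)))
      (comp_le_comp (hX.comp_le n) (le_refl (ι' (n + 1))))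
    rwa [Category.id_comp, Category.assoc, h'.comp_ι, ← Category.assoc, h.π_comp] at this

theorem IsBilimit.ι_comp_comp (h : IsBilimit e p ι π) (h' : IsBilimit e p ι' π') {m n : ℕ}
    (hmn : m ≤ n) : ι m ≫ π n ≫ ι' n = ι' m := by
  induction hmn using Nat.decreasingInduction with
  | self => rw [reassoc_of% (h.comp_eq n)]
  | of_succ m _ ih => rw [← h.comp_ι m, Category.assoc, ih, h'.comp_ι]

theorem IsBilimit.comp_comp_π (h : IsBilimit e p ι π) (h' : IsBilimit e p ι' π') {m n : ℕ}
    (hmn : m ≤ n) : (π n ≫ ι' n) ≫ π' m = π m := by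
  induction hmn using Nat.decreasingInduction with
  | self => rw [Category.assoc, h'.comp_eq, Category.comp_id]
  | of_succ m _ ih => rw [← h'.π_comp m, ← Category.assoc, ih, h.π_comp]

/-- Bilimits are unique up to isomorphism. -/
theorem IsBilimit.exists_iso (hX : IsEPChain X e p) (h : IsBilimit e p ι π)
    (h' : IsBilimit e p ι' π') :
    ∃ i : B ≅ B', (∀ n, ι n ≫ i.hom = ι' n) ∧ ∀ n, i.inv ≫ π n = π' n := by
  have hi := h.monotone_comp hX h'
  have hj := h'.monotone_comp hX h
  -- The two inverse maps are the suprema of `π n ≫ ι' n` and of `π' n ≫ ι n`; in the composites the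
  -- middle factor cancels, leaving the sequences with supremum the identity.
  obtain ⟨i, hi'⟩ := exists_isLUB_of_monotone hi
  obtain ⟨j, hj'⟩ := exists_isLUB_of_monotone hj
  refine ⟨⟨i, j, ?_, ?_⟩, fun n => ?_, fun n => ?_⟩
  · refine (isLUB_comp hi hj hi' hj').unique ?_
    simpa [reassoc_of% h'.comp_eq] using h.isLUB
  · refine (isLUB_comp hj hi hj' hi').unique ?_
    simpa [reassoc_of% h.comp_eq] using h'.isLUB
  · have hc := CPOCategory.comp_continuous_right (Z := B') (ι n)
    exact (isLUB_map hc hi hi').unique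
      (isLUB_of_eventually_eq (hc.monotone.comp hi) fun _ hm => h.ι_comp_comp h' hm)
  · have hc := CPOCategory.comp_continuous_left (X := B') (π n)
    exact (isLUB_map hc hj hj').unique
      (isLUB_of_eventually_eq (hc.monotone.comp hj) fun _ hm => h'.comp_comp_π h hm)

end Uniqueness

/-! ### The limit-colimit coincidence -/

section Coincidence

variable {X : ℕ → C} {e : ∀ n, X n ⟶ X (n + 1)} {p : ∀ n, X (n + 1) ⟶ X n}

theorem IsEPChain.map_comp_map (hX : IsEPChain X e p) {m n : ℕ} (h : m ≤ n) :
    (Functor.ofSequence e).map (homOfLE h) ≫ (Functor.ofOpSequence p).map (homOfLE h).op =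
        𝟙 (X m) ∧
      (Functor.ofOpSequence p).map (homOfLE h).op ≫ (Functor.ofSequence e).map (homOfLE h) ≤
        𝟙 (X n) := by
  induction n, h using Nat.le_induction with
  | base =>
    have h₁ : (Functor.ofSequence e).map (homOfLE (le_refl m)) = 𝟙 (X m) :=
      (Functor.ofSequence e).map_id m
    have h₂ : (Functor.ofOpSequence p).map (homOfLE (le_refl m)).op = 𝟙 (X m) :=
      (Functor.ofOpSequence p).map_id _
    rw [h₁, h₂]
    exact ⟨Category.comp_id _, (Category.comp_id _).le⟩
  | succ n h ih =>
    obtain ⟨ih₁, ih₂⟩ := ih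
    have h₁ : (Functor.ofSequence e).map (homOfLE (Nat.le_succ_of_le h)) =
        (Functor.ofSequence e).map (homOfLE h) ≫ e n :=
      ((Functor.ofSequence e).map_comp (homOfLE h) (homOfLE (Nat.le_add_right n 1))).trans
        (congrArg _ (Functor.ofSequence_map_homOfLE_succ e n))
    have h₂ : (Functor.ofOpSequence p).map (homOfLE (Nat.le_succ_of_le h)).op =
        p n ≫ (Functor.ofOpSequence p).map (homOfLE h).op :=
      ((Functor.ofOpSequence p).map_comp (homOfLE (Nat.le_add_right n 1)).op (homOfLE h).op).trans
        (congrArg (· ≫ (Functor.ofOpSequence p).map (homOfLE h).op)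
          (Functor.ofOpSequence_map_homOfLE_succ p n))
    rw [h₁, h₂]
    generalize (Functor.ofSequence e).map (homOfLE h) = E at *
    generalize (Functor.ofOpSequence p).map (homOfLE h).op = P at *
    change X m ⟶ X n at E
    change X n ⟶ X m at P
    change E ≫ P = 𝟙 (X m) at ih₁
    change P ≫ E ≤ 𝟙 (X n) at ih₂
    change (E ≫ e n) ≫ p n ≫ P = 𝟙 (X m) ∧ (p n ≫ P) ≫ E ≫ e n ≤ 𝟙 (X (n + 1))
    constructor
    · rw [Category.assoc, reassoc_of% (hX.comp_eq n), ih₁]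
    · have := comp_le_comp (le_refl (p n)) (comp_le_comp ih₂ (le_refl (e n)))
      rw [Category.id_comp] at this
      simpa using this.trans (hX.comp_le n)

/-- The limit-colimit coincidence: the projections are induced by the cocones `X m → X k → X n` that
go up by embeddings and down by projections, where `k ≥ m, n` is arbitrary by `hEP'`. -/
theorem IsEPChain.exists_isBilimit (hX : IsEPChain X e p) [HasColimit (Functor.ofSequence e)] :
    ∃ (B : C) (ι : ∀ n, X n ⟶ B) (π : ∀ n, B ⟶ X n), IsBilimit e p ι π := by
  let E (m n : ℕ) (h : m ≤ n) : X m ⟶ X n := (Functor.ofSequence e).map (homOfLE h)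
  let P (m n : ℕ) (h : m ≤ n) : X n ⟶ X m := (Functor.ofOpSequence p).map (homOfLE h).op
  have hE (k m n : ℕ) (h : k ≤ m) (h' : m ≤ n) : E k m h ≫ E m n h' = E k n (h.trans h') :=
    ((Functor.ofSequence e).map_comp (homOfLE h) (homOfLE h')).symm
  have hP (k m n : ℕ) (h : k ≤ m) (h' : m ≤ n) : P m n h' ≫ P k m h = P k n (h.trans h') :=
    ((Functor.ofOpSequence p).map_comp (homOfLE h').op (homOfLE h).op).symm
  have hE₁ (n : ℕ) : E n (n + 1) (Nat.le_succ n) = e n := Functor.ofSequence_map_homOfLE_succ e n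
  have hP₁ (n : ℕ) : P n (n + 1) (Nat.le_succ n) = p n :=
    Functor.ofOpSequence_map_homOfLE_succ p n
  have hEP (m n : ℕ) (h : m ≤ n) : E m n h ≫ P m n h = 𝟙 (X m) := (hX.map_comp_map h).1
  have hEP' (m n k l : ℕ) (h : m ≤ k) (h' : n ≤ k) (hkl : k ≤ l) :
      E m l (h.trans hkl) ≫ P n l (h'.trans hkl) = E m k h ≫ P n k h' := by
    rw [← hE m k l h hkl, ← hP n k l h' hkl, Category.assoc, reassoc_of% (hEP k l hkl)]
  let ι (n : ℕ) : X n ⟶ colimit (Functor.ofSequence e) := colimit.ι (Functor.ofSequence e) n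
  have hι (m n : ℕ) (h : m ≤ n) : E m n h ≫ ι n = ι m := colimit.w _ (homOfLE h)
  have hext {Y : C} {f g : colimit (Functor.ofSequence e) ⟶ Y} (h : ∀ n, ι n ≫ f = ι n ≫ g) :
      f = g := colimit.hom_ext h
  let s (n : ℕ) : Cocone (Functor.ofSequence e) :=
    { pt := X n
      ι :=
        { app := fun m => E m (m + n) (by lia) ≫ P n (m + n) (by lia)
          naturality := fun m m' f => by
            have h := leOfHom f
            change E m m' h ≫ E m' (m' + n) _ ≫ P n (m' + n) _ =
              (E m (m + n) _ ≫ P n (m + n) _) ≫ 𝟙 (X n)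
            rw [Category.comp_id, ← Category.assoc, hE]
            exact hEP' m n (m + n) (m' + n) _ _ (by lia) } }
  let π (n : ℕ) : colimit (Functor.ofSequence e) ⟶ X n := colimit.desc _ (s n)
  have hπ₀ (m n : ℕ) : ι m ≫ π n = E m (m + n) (by lia) ≫ P n (m + n) (by lia) :=
    colimit.ι_desc (s n) m
  have hπ (m n k : ℕ) (h : m ≤ k) (h' : n ≤ k) : ι m ≫ π n = E m k h ≫ P n k h' := by
    rw [hπ₀, ← hEP' m n k (k + (m + n)) h h' (by lia)]
    exact (hEP' m n (m + n) (k + (m + n)) _ _ (by lia)).symm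
  have hid (n : ℕ) : ι n ≫ π n = 𝟙 (X n) := by
    rw [hπ n n n le_rfl le_rfl, hEP]
  have hιe (n : ℕ) : e n ≫ ι (n + 1) = ι n := by rw [← hE₁, hι]
  have hπp (n : ℕ) : π (n + 1) ≫ p n = π n := by
    refine hext fun m => ?_
    rw [← Category.assoc, hπ m (n + 1) (m + (n + 1)) (by lia) (by lia),
      hπ m n (m + (n + 1)) (by lia) (by lia), Category.assoc, ← hP₁, hP]
  have hmono : Monotone fun n => π n ≫ ι n := by
    refine monotone_nat_of_le_succ fun n => ?_
    have := comp_le_comp (le_refl (π (n + 1))) (comp_le_comp (hX.comp_le n) (le_refl (ι (n + 1))))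
    rwa [Category.id_comp, Category.assoc, hιe, ← Category.assoc, hπp] at this
  refine ⟨_, ι, π, hid, hιe, hπp, hmono, ?_⟩
  obtain ⟨f, hf⟩ := exists_isLUB_of_monotone hmono
  -- The supremum exists in the hom-cpo. The colimit legs identify it, since after `ι m` the
  -- sequence is constant from index `m` on.
  suffices f = 𝟙 _ by rwa [this] at hf
  refine hext fun m => ?_
  rw [Category.comp_id]
  have hc := CPOCategory.comp_continuous_right (Z := colimit (Functor.ofSequence e)) (ι m)
  refine (isLUB_map hc hmono hf).unique
    (isLUB_of_eventually_eq (hc.monotone.comp hmono) (m := m) fun n h => ?_)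
  change ι m ≫ π n ≫ ι n = ι m
  rw [← Category.assoc, hπ m n n h le_rfl, Category.assoc, ← hι m n h]
  have : P n n le_rfl = 𝟙 (X n) := (Functor.ofOpSequence p).map_id _
  rw [this, Category.id_comp]

end Coincidence

theorem hasBilimits_of_hasColimit
    (h : ∀ K : ℕ ⥤ C, (∀ {m n : ℕ} (f : m ⟶ n), IsEmbedding (K.map f)) → HasColimit K) :
    HasBilimits C := by
  intro X e p hX
  have := h (Functor.ofSequence e) fun f => ⟨_, hX.map_comp_map (leOfHom f)⟩
  exact hX.exists_isBilimit

/-! ### Algebraic compactness from minimal invariants -/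

/-- An isomorphism `i : S Ω ≅ Ω` such that the identity of `Ω` is the supremum of the iterates
of `f ↦ i ∘ S f ∘ i⁻¹` at the zero endomorphism. -/
structure IsMinimalInvariant (S : C ⥤ C) (Z : C) {Ω : C} (i : S.obj Ω ≅ Ω)
    (c : ℕ → (Ω ⟶ Ω)) : Prop where
  zero : ∃ (a : Ω ⟶ Z) (b : Z ⟶ Ω), c 0 = a ≫ b
  succ n : c (n + 1) = i.inv ≫ S.map (c n) ≫ i.hom
  monotone : Monotone c
  isLUB : IsLUB (Set.range c) (𝟙 Ω)

/-- Let `Ω` be the bilimit of `Z → S Z → S S Z → ⋯`. Then `S Ω` and `Ω` are both bilimits of the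
chain without its first term, hence isomorphic. -/
theorem exists_isMinimalInvariant (hC : HasBilimits C) {Z : C} (hZ : IsLeastZero Z)
    (S : CPOFunctor C C) :
    ∃ (Ω : C) (i : S.toFunctor.obj Ω ≅ Ω) (c : ℕ → (Ω ⟶ Ω)),
      IsMinimalInvariant S.toFunctor Z i c := by
  let X (n : ℕ) : C := Nat.rec Z (fun _ Y => S.toFunctor.obj Y) n
  let e (n : ℕ) : X n ⟶ X (n + 1) :=
    Nat.rec (motive := fun n => X n ⟶ X (n + 1)) (hZ.isZero.to_ _)
      (fun _ f => S.toFunctor.map f) n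
  let p (n : ℕ) : X (n + 1) ⟶ X n :=
    Nat.rec (motive := fun n => X (n + 1) ⟶ X n) (hZ.isZero.from_ _)
      (fun _ f => S.toFunctor.map f) n
  have hX : IsEPChain X e p := by
    refine ⟨fun n => ?_, fun n => ?_⟩
    · induction n with
      | zero => exact hZ.isZero.eq_of_src _ _
      | succ n ih =>
        exact (S.toFunctor.map_comp _ _).symm.trans
          ((congrArg S.toFunctor.map ih).trans (S.toFunctor.map_id _))
    · induction n with
      | zero => exact hZ.comp_le_id _ _
      | succ n ih =>
        have := (S.continuous_map _ _).monotone ih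
        rwa [S.toFunctor.map_id, S.toFunctor.map_comp] at this
  obtain ⟨Ω, ι, π, hΩ⟩ := hC X e p hX
  obtain ⟨i, hi, hj⟩ := (hΩ.map S).exists_iso (hX.map S) hΩ.shift
  refine ⟨Ω, i, fun n => π n ≫ ι n, ⟨π 0, ι 0, rfl⟩, fun n => ?_, hΩ.monotone, hΩ.isLUB⟩
  change π (n + 1) ≫ ι (n + 1) = i.inv ≫ S.toFunctor.map (π n ≫ ι n) ≫ i.hom
  rw [← hi n, ← hj n, S.toFunctor.map_comp, Category.assoc, Category.assoc]

theorem IsMinimalInvariant.existsUnique_algebraHom {S : CPOFunctor C C} {Z : C}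
    (hZ : IsLeastZero Z) {Ω : C} {i : S.toFunctor.obj Ω ≅ Ω} {c : ℕ → (Ω ⟶ Ω)}
    (h : IsMinimalInvariant S.toFunctor Z i c) {Y : C} (a : S.toFunctor.obj Y ⟶ Y) :
    ∃! f : Ω ⟶ Y, S.toFunctor.map f ≫ a = i.hom ≫ f := by
  have hφ : ωScottContinuous fun f : Ω ⟶ Y => i.inv ≫ S.toFunctor.map f ≫ a :=
    (CPOCategory.comp_continuous_right i.inv).comp
      ((CPOCategory.comp_continuous_left a).comp (S.continuous_map Ω Y))
  -- Homomorphisms are the fixed points of `f ↦ a ∘ S f ∘ i⁻¹`; the zero morphism, being least,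
  -- starts the iteration.
  obtain ⟨f, hf⟩ := exists_fixedPoint hφ
    (hZ.comp_le (hZ.isZero.from_ Ω) (hZ.isZero.to_ Y) _)
  refine ⟨f, (Iso.eq_inv_comp i).1 hf.symm |>.symm, fun g hg => ?_⟩
  -- Two homomorphisms agree on every approximation `c n` of the identity, hence on the supremum.
  have hc (n : ℕ) : c n ≫ g = c n ≫ f := by
    induction n with
    | zero =>
      obtain ⟨x, y, hxy⟩ := h.zero
      rw [hxy, Category.assoc, Category.assoc, hZ.isZero.eq_of_src (y ≫ g) (y ≫ f)]
    | succ n ih =>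
      have hf' : i.hom ≫ f = S.toFunctor.map f ≫ a := by rw [← Iso.eq_inv_comp, hf]
      simp only [h.succ, Category.assoc, ← hg, hf']
      rw [← Functor.map_comp_assoc, ← Functor.map_comp_assoc, ih]
  have hg' := isLUB_map (CPOCategory.comp_continuous_left g) h.monotone h.isLUB
  simp only [hc, Category.id_comp] at hg'
  have hf' := isLUB_map (CPOCategory.comp_continuous_left f) h.monotone h.isLUB
  rw [Category.id_comp] at hf'
  exact hg'.unique hf'

theorem IsMinimalInvariant.existsUnique_coalgebraHom {S : CPOFunctor C C} {Z : C}
    (hZ : IsLeastZero Z) {Ω : C} {i : S.toFunctor.obj Ω ≅ Ω} {c : ℕ → (Ω ⟶ Ω)}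
    (h : IsMinimalInvariant S.toFunctor Z i c) {Y : C} (a : Y ⟶ S.toFunctor.obj Y) :
    ∃! f : Y ⟶ Ω, a ≫ S.toFunctor.map f = f ≫ i.inv := by
  -- Minimal invariance is self-dual, so finality is initiality in the opposite category.
  have hop : IsMinimalInvariant S.op.toFunctor (Opposite.op Z) i.symm.op fun n => (c n).op := by
    obtain ⟨x, y, hxy⟩ := h.zero
    refine ⟨⟨y.op, x.op, congrArg Quiver.Hom.op hxy⟩, fun n => ?_, fun _ _ hmn => h.monotone hmn,
      ?_, fun f hf => h.isLUB.2 (?_ : f.unop ∈ _)⟩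
    · simp [h.succ, CPOFunctor.op]
    · rintro _ ⟨n, rfl⟩
      exact h.isLUB.1 ⟨n, rfl⟩
    · rintro _ ⟨n, rfl⟩
      exact hf ⟨n, rfl⟩
  obtain ⟨f, hf, hf'⟩ := hop.existsUnique_algebraHom hZ.op a.op
  exact ⟨f.unop, Quiver.Hom.op_inj hf, fun g hg =>
    Quiver.Hom.op_inj (hf' g.op (Quiver.Hom.unop_inj hg))⟩

/-- Only the middle category `D` needs a zero object and bilimits: the minimal invariant is that of
`L ∘ K` on `D`, and `K` carries it to `C`. -/
theorem algebraicallyCompact_comp (hD : HasBilimits D) {Z : D} (hZ : IsLeastZero Z)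
    (L : CPOFunctor C D) (K : CPOFunctor D C) :
    AlgebraicallyCompact (L.comp K).toFunctor := by
  obtain ⟨Ω, i, c, h⟩ := exists_isMinimalInvariant hD hZ (K.comp L)
  exact algebraicallyCompact_of_existsUnique (K.toFunctor.mapIso i)
    (existsUnique_algebraHom_comp (L := L.toFunctor) (K := K.toFunctor) i
      fun _ => h.existsUnique_algebraHom hZ)
    (existsUnique_coalgebraHom_comp (L := L.toFunctor) (K := K.toFunctor) i
      fun _ => h.existsUnique_coalgebraHom hZ)

end Category

/-- Every type over `T = G ∘ F` factors through `F^op × F`. -/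
theorem exists_factor {D : Type w} [Category.{u} D] [CPOCategory D] (F : CPOFunctor ωCPO.{u} D)
    (G : CPOFunctor D ωCPO.{u}) (A : MixedType.{u}) :
    ∃ K : CPOFunctor (Dᵒᵖ × D) (ωCPO.{u}ᵒᵖ × ωCPO.{u}),
      interp (F.comp G) A = (F.op.prod F).comp K := by
  -- `Fᵒᵖ × F` commutes with the swap, so it can be pulled out of both components of `cup`.
  have hcup (N : CPOFunctor (Dᵒᵖ × D) ωCPO.{u}) : ((F.op.prod F).comp N).cup =
      (F.op.prod F).comp (((CPOFunctor.swap D).comp N.op).pair N) := rfl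
  induction A with
  | const c => exact ⟨.const _ (op c, c), rfl⟩
  | monad => exact ⟨G.op.prod G, rfl⟩
  | app H A ih =>
    obtain ⟨K, hK⟩ := ih
    exact ⟨K.comp (H.op.prod H), by rw [interp, hK]; rfl⟩
  | sum A B ihA ihB =>
    obtain ⟨K, hK⟩ := ihA
    obtain ⟨K', hK'⟩ := ihB
    rw [interp, hK, hK']
    exact ⟨_, hcup (((K.comp (CPOFunctor.proj₂ _ _)).pair
      (K'.comp (CPOFunctor.proj₂ _ _))).comp sumFunctor)⟩
  | prod A B ihA ihB =>
    obtain ⟨K, hK⟩ := ihA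
    obtain ⟨K', hK'⟩ := ihB
    rw [interp, hK, hK']
    exact ⟨_, hcup (((K.comp (CPOFunctor.proj₂ _ _)).pair
      (K'.comp (CPOFunctor.proj₂ _ _))).comp prodFunctor)⟩
  | arrow A B ihA ihB =>
    obtain ⟨K, hK⟩ := ihA
    obtain ⟨K', hK'⟩ := ihB
    rw [interp, hK, hK']
    exact ⟨_, hcup (((K.comp (CPOFunctor.proj₁ _ _)).pair
      (K'.comp (CPOFunctor.proj₂ _ _))).comp homFunctor)⟩

/-! ### LNL-FPC models -/

section Model

variable {D : Type w} [Category.{u} D] [CPOCategory D] [MonoidalCategory D]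
  [SymmetricCategory D] [MonoidalClosed D]

/-- In a CPO-symmetric monoidal closed category an e-initial object is a zero object, as its
internal endomorphism object is terminal. -/
theorem isLeastZero_of_eInitial {Z : D} (hZ : IsInitial Z)
    (he : ∀ (X : D) (e : Z ⟶ X), IsEmbedding e) : IsLeastZero Z := by
  -- By currying and symmetry, maps `X → [Z, Z]` correspond to maps `Z → [X, Z]`, which are unique.
  have hW (X : D) : Subsingleton (X ⟶ (ihom Z).obj Z) := by
    refine ⟨fun f g => ((ihom.adjunction Z).homEquiv X Z).symm.injective ?_⟩
    refine (cancel_epi (β_ X Z).hom).1 (((ihom.adjunction X).homEquiv Z Z).injective ?_)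
    exact hZ.hom_ext _ _
  -- `Z` is a retract of `[Z, Z]`, so parallel maps into `Z` are equal too.
  obtain ⟨q, hq, -⟩ := he _ (hZ.to ((ihom Z).obj Z))
  have hsub (X : D) (f g : X ⟶ Z) : f = g := by
    rw [← Category.comp_id f, ← Category.comp_id g, ← hq, ← Category.assoc, ← Category.assoc,
      (hW X).elim (f ≫ _) (g ≫ _)]
  refine ⟨⟨fun Y => ⟨⟨⟨hZ.to Y⟩, fun _ => hZ.hom_ext _ _⟩⟩, fun Y => ?_⟩, fun {X} a b => ?_⟩
  · obtain ⟨r, -⟩ := he Y (hZ.to Y)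
    exact ⟨⟨⟨r⟩, fun _ => hsub _ _ _⟩⟩
  -- Uniqueness of maps into `Z` makes `a` the projection belonging to the embedding `b`.
  · obtain ⟨r, -, hr⟩ := he X b
    rwa [hsub X a r]

end Model

end LNLFPC

theorem mainTheorem4 {D : Type w} [Category.{u} D] [LNLFPC.CPOCategory D] [MonoidalCategory D]
    [SymmetricCategory D] [MonoidalClosed D] (M : LNLFPC.LNLFPCModel.{w, u} D)
    (A : LNLFPC.MixedType.{u}) :
    (∃ K : LNLFPC.CPOFunctor (Dᵒᵖ × D) (ωCPO.{u}ᵒᵖ × ωCPO.{u}),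
      LNLFPC.interp M.T A = (M.F.op.prod M.F).comp K) ∧
    LNLFPC.AlgebraicallyCompact (LNLFPC.interp M.T A).toFunctor := by
  obtain ⟨K, hK⟩ := LNLFPC.exists_factor M.F M.G A
  obtain ⟨Z, ⟨hZ⟩, he⟩ := M.eInitial
  have hzero := LNLFPC.isLeastZero_of_eInitial hZ he
  have hbi : LNLFPC.HasBilimits D := LNLFPC.hasBilimits_of_hasColimit fun P hP => M.hasColimit P hP
  refine ⟨⟨K, hK⟩, ?_⟩
  change LNLFPC.AlgebraicallyCompact (LNLFPC.interp (M.F.comp M.G) A).toFunctor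
  rw [hK]
  exact LNLFPC.algebraicallyCompact_comp (hbi.op.prod hbi) (hzero.op.prod hzero) _ K
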